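/- Let $1\le l\le m$ be integers. For $0\le j\le m$ let $(\alpha_n^{(j)})_{n\ge 0}$ be sequences of complex numbers with $\alpha_n^{(0)}\alpha_n^{(m)}\neq 0$ for all $n\ge 0$, such that the limits $\alpha^{(j)}=\lim_{n\to\infty}\alpha_n^{(j)}$ exist in $\mathbb{C}$ and $\alpha^{(0)}\alpha^{(m)}\ne 0$. Let $(x_n^{(1)})_{n\ge0},\dots,(x_n^{(l)})_{n\ge0}$ be solutions of $$\alpha_n^{(m)}x_{n+m}+\alpha_n^{(m-1)}x_{n+m-1}+\cdots+\alpha_n^{(0)}x_n=0\qquad(n\ge 0)$$ that are linearly independent over $\mathbb{C}$. Let $\boldsymbol\Psi=[\Psi^{(i,j)}]_{1\le i,j\le m}$ be the limiting companion matrix, given by $\Psi^{(i,i+1)}=1$ for $1\le i\le m-1$, $\Psi^{(m,j)}=-\alpha^{(j-1)}/\alpha^{(m)}$ for $1\le j\le m$, and $\Psi^{(i,j)}=0$ otherwise, and let $\lambda_1,\dots,\lambda_m$ be its eigenvalues, repeated according to algebraic multiplicity. For $n\ge 0$ and $1\le\mu_1<\cdots<\mu_l\le m$ let $$D_n^{\boldsymbol\mu}=\det\left[x_{n+\mu_i-1}^{(j)}\right]_{1\le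 i,j\le l},$$ so that the $D_n^{\boldsymbol\mu}$ are the $l\times l$ minors of the $m\times l$ Casoratian matrix $[x_{n+i-1}^{(j)}]_{1\le i\le m,\,1\le j\le l}$. Then there are indices $1\le\nu_1<\cdots<\nu_l\le m$ such that, for every norm $\|\cdot\|$ on $\mathbb{C}^{\binom ml}$, $$\lim_{n\to\infty}\sqrt[n]{\big\|(D_n^{\boldsymbol\mu})_{1\le\mu_1<\cdots<\mu_l\le m}\big\|}=|\lambda_{\nu_1}\cdots\lambda_{\nu_l}|.$$ -/

import Mathlib

/-- The sequence `x` solves the linear recurrence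
`α n m * x (n + m) + ⋯ + α n 0 * x n = 0` for all `n`. -/
def IsRecurrenceSolution {m : ℕ} (α : ℕ → Fin (m + 1) → ℂ) (x : ℕ → ℂ) : Prop :=
  ∀ n : ℕ, ∑ j : Fin (m + 1), α n j * x (n + (j : ℕ)) = 0

/-- The companion matrix of the recurrence `a m * x (n + m) + ⋯ + a 0 * x n = 0`: its last row is
`(-a 0 / a m, …, -a (m - 1) / a m)`, it has ones just above the diagonal, and zeros elsewhere. -/
noncomputable def companionMatrix {m : ℕ} (a : Fin (m + 1) → ℂ) : Matrix (Fin m) (Fin m) ℂ :=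
  Matrix.of fun i j =>
    if (i : ℕ) + 1 = m then -(a j.castSucc / a (Fin.last m))
    else if (j : ℕ) = (i : ℕ) + 1 then 1 else 0

/-- The `m × l` Casoratian matrix at `n` of the sequences `x j`: its `(i, j)` entry
(with `i`, `j` counted from zero) is `x j (n + i)`. -/
def casoratian (m : ℕ) {l : ℕ} (x : Fin l → ℕ → ℂ) (n : ℕ) : Matrix (Fin m) (Fin l) ℂ :=
  Matrix.of fun i j => x j (n + (i : ℕ))

/-- The vector of the `l × l` minors of an `m × l` matrix, indexed by the choices
`μ 0 < ⋯ < μ (l - 1)` of `l` of its rows. -/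
def minorVector {m l : ℕ} (A : Matrix (Fin m) (Fin l) ℂ) : (Fin l ↪o Fin m) → ℂ :=
  fun μ => (A.submatrix μ id).det

open Filter Topology

/-! The minor vector of the Casoratian evolves by the `l`-th compound of the companion matrix, and
that compound converges. Its limit has the products `∏ i, lam (μ i)` as eigenvalues. Fix `r`
different from all their moduli. A change of basis makes the limiting companion matrix as close as
desired to `Matrix.diagonal lam`, so in the sup norm the minor vector is eventually almost
multiplied, coordinate by coordinate, by these products. Coordinates of modulus above `r` then beat
the others once they dominate, and keep dominating; if they never do, the vector contracts
(`growth_dichotomy`). So each such `r` lies strictly on one side of the growth rate, and as only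
finitely many moduli are excluded, the `n`-th root converges to one of them. The basis depends on
`r`, but it costs only constant factors, as does the choice of norm. -/

/-! ### Growth rates of sequences -/

/-- If every real number outside a finite set `F` of exponents is either strictly above an
exponential upper rate or strictly below an exponential lower rate of `w`, then the `n`-th roots
of `w` converge to an element of `F`. -/
theorem exists_tendsto_rpow_of_dichotomy {F : Set ℝ} (hF : F.Finite) (w : ℕ → ℝ)
    (hw : ∀ n, 0 < w n)
    (h : ∀ r, 0 ≤ r → r ∉ F →
      (∃ s, 0 ≤ s ∧ s < r ∧ ∃ C > 0, ∀ᶠ n in atTop, w n ≤ C * s ^ n) ∨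
      ((∃ f ∈ F, r < f) ∧ ∃ s, r < s ∧ ∃ c > 0, ∀ᶠ n in atTop, c * s ^ n ≤ w n)) :
    ∃ ρ ∈ F, Tendsto (fun n : ℕ => w n ^ (1 / (n : ℝ))) atTop (𝓝 ρ) := by
  set U : Set ℝ := {s | 0 ≤ s ∧ ∃ C > 0, ∀ᶠ n in atTop, w n ≤ C * s ^ n} with hU
  have hbdd : BddBelow U := ⟨0, fun s hs => hs.1⟩
  have hne : U.Nonempty := by
    obtain ⟨B, hB⟩ := hF.bddAbove
    have hlt : ∀ f ∈ F, f < max B 0 + 1 := fun f hf => by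
      have := hB hf
      have := le_max_left B 0
      linarith
    -- An `r` above all of `F` rules out the second alternative, so some upper rate exists.
    rcases h (max B 0 + 1) (by positivity) (fun hm => lt_irrefl _ (hlt _ hm)) with
      ⟨s, hs0, -, hs⟩ | ⟨⟨f, hf, hlt'⟩, -⟩
    · exact ⟨s, hs0, hs⟩
    · exact absurd (hlt f hf) (not_lt.2 hlt'.le)
  have hroot : ∀ c : ℝ, 0 < c → ∀ s : ℝ, 0 ≤ s →
      Tendsto (fun n : ℕ => (c * s ^ n) ^ (1 / (n : ℝ))) atTop (𝓝 s) := by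
    intro c hc s hs
    have h1 : Tendsto (fun n : ℕ => c ^ (1 / (n : ℝ)) * s) atTop (𝓝 (c ^ (0 : ℝ) * s)) :=
      ((tendsto_const_nhds.rpow tendsto_one_div_atTop_nhds_zero_nat (Or.inl hc.ne')).mul_const s)
    rw [Real.rpow_zero, one_mul] at h1
    refine h1.congr' ?_
    filter_upwards [eventually_ne_atTop 0] with n hn
    rw [Real.mul_rpow hc.le (pow_nonneg hs n), one_div, Real.pow_rpow_inv_natCast hs hn]
  have hup : ∀ C > 0, ∀ s, 0 ≤ s → (∀ᶠ n in atTop, w n ≤ C * s ^ n) →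
      ∀ t, s < t → ∀ᶠ n : ℕ in atTop, w n ^ (1 / (n : ℝ)) < t := by
    intro C hC s hs hws t hst
    filter_upwards [hws, (hroot C hC s hs).eventually (gt_mem_nhds hst)] with n h1 h2
    exact (Real.rpow_le_rpow (hw n).le h1 (by positivity)).trans_lt h2
  have hlow : ∀ c > 0, ∀ s, 0 ≤ s → (∀ᶠ n in atTop, c * s ^ n ≤ w n) →
      ∀ t, t < s → ∀ᶠ n : ℕ in atTop, t < w n ^ (1 / (n : ℝ)) := by
    intro c hc s hs hws t hst
    filter_upwards [hws, (hroot c hc s hs).eventually (lt_mem_nhds hst)] with n h1 h2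
    exact h2.trans_le (Real.rpow_le_rpow (by positivity) h1 (by positivity))
  have hρ0 : 0 ≤ sInf U := le_csInf hne fun s hs => hs.1
  have hupρ : ∀ t, sInf U < t → ∀ᶠ n : ℕ in atTop, w n ^ (1 / (n : ℝ)) < t := by
    intro t ht
    obtain ⟨s, ⟨hs0, C, hC, hs⟩, hst⟩ := exists_lt_of_csInf_lt hne ht
    exact hup C hC s hs0 hs t hst
  have hhigh : ∀ r, 0 ≤ r → r ∉ F → r ≤ sInf U →
      ∃ s, r < s ∧ ∀ t < s, ∀ᶠ n : ℕ in atTop, t < w n ^ (1 / (n : ℝ)) := by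
    intro r hr hrF hrU
    rcases h r hr hrF with ⟨s, hs0, hsr, hs⟩ | ⟨-, s, hrs, c, hc, hs⟩
    · exact absurd (csInf_le hbdd (show s ∈ U from ⟨hs0, hs⟩)) (by linarith)
    · exact ⟨s, hrs, hlow c hc s (hr.trans hrs.le) hs⟩
  refine ⟨sInf U, ?_, tendsto_order.2 ⟨fun t ht => ?_, hupρ⟩⟩
  · by_contra hρF
    obtain ⟨s, hs, hs'⟩ := hhigh _ hρ0 hρF le_rfl
    obtain ⟨t, ht1, ht2⟩ := exists_between hs
    obtain ⟨n, h1, h2⟩ := ((hs' t ht2).and (hupρ t ht1)).exists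
    exact lt_asymm h1 h2
  · by_cases ht0 : t < 0
    · exact Eventually.of_forall fun n => ht0.trans_le (Real.rpow_nonneg (hw n).le _)
    -- Finiteness of `F` leaves an admissible `r` between `t` and the infimum of the upper rates.
    · obtain ⟨r, hr, hrF⟩ := (Set.Ioo_infinite ht).exists_notMem_finite hF
      obtain ⟨s, hs, hs'⟩ := hhigh r ((not_lt.1 ht0).trans hr.1.le) hrF hr.2.le
      exact hs' t (hr.1.trans hs)

/-- A nonvanishing sequence of vectors that is almost multiplied by a fixed diagonal matrix in
each step either grows strictly slower or strictly faster than `r ^ n`, when `r` keeps a distance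
of at least `2 * δ` from the moduli of the diagonal entries. -/
theorem growth_dichotomy {ι : Type*} [Fintype ι] (κ : ι → ℂ) {r δ : ℝ} (hδ : 0 < δ)
    (hr : 0 ≤ r) (hκ : ∀ i, 2 * δ ≤ |‖κ i‖ - r|) (z : ℕ → ι → ℂ) (hz : ∀ n, z n ≠ 0)
    (hstep : ∀ᶠ n in atTop, ∀ i, ‖z (n + 1) i - κ i * z n i‖ ≤ δ * ‖z n‖) :
    (∃ s, 0 ≤ s ∧ s < r ∧ ∃ C > 0, ∀ᶠ n in atTop, ‖z n‖ ≤ C * s ^ n) ∨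
    ((∃ i, r < ‖κ i‖) ∧ ∃ s, r < s ∧ ∃ c > 0, ∀ᶠ n in atTop, c * s ^ n ≤ ‖z n‖) := by
  have hattain : ∀ n, ∃ i, ‖z n i‖ = ‖z n‖ := by
    intro n
    obtain ⟨j, hj⟩ : ∃ j, z n j ≠ 0 := by
      by_contra! hcon
      exact hz n (funext hcon)
    have : Nonempty ι := ⟨j⟩
    obtain ⟨i, hi⟩ := Finite.exists_max fun i => ‖z n i‖
    exact ⟨i, le_antisymm (norm_le_pi_norm _ _) ((pi_norm_le_iff_of_nonneg (norm_nonneg _)).2 hi)⟩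
  obtain ⟨M, hM⟩ := eventually_atTop.1 hstep
  have hsmall : ∀ n ≥ M, ∀ i, ‖κ i‖ < r → ‖z (n + 1) i‖ ≤ (r - δ) * ‖z n‖ := by
    intro n hn i hi
    have h1 := hκ i
    rw [abs_of_neg (by linarith)] at h1
    have h2 := hM n hn i
    have h3 : ‖z (n + 1) i‖ ≤ ‖z (n + 1) i - κ i * z n i‖ + ‖κ i * z n i‖ := by
      simpa using norm_add_le (z (n + 1) i - κ i * z n i) (κ i * z n i)
    rw [norm_mul] at h3
    have h4 : ‖κ i‖ * ‖z n i‖ ≤ (r - 2 * δ) * ‖z n‖ :=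
      mul_le_mul (by linarith) (norm_le_pi_norm _ _) (norm_nonneg _)
        (by linarith [norm_nonneg (κ i)])
    linarith
  have hbig : ∀ n ≥ M, ∀ i, r < ‖κ i‖ → ‖z n i‖ = ‖z n‖ → (r + δ) * ‖z n‖ ≤ ‖z (n + 1) i‖ := by
    intro n hn i hi hin
    have h1 := hκ i
    rw [abs_of_pos (by linarith)] at h1
    have h2 := hM n hn i
    have h3 : ‖κ i * z n i‖ ≤ ‖z (n + 1) i‖ + ‖z (n + 1) i - κ i * z n i‖ := by
      simpa using norm_sub_le (z (n + 1) i) (z (n + 1) i - κ i * z n i)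
    rw [norm_mul, hin] at h3
    have h4 : (r + 2 * δ) * ‖z n‖ ≤ ‖κ i‖ * ‖z n‖ :=
      mul_le_mul_of_nonneg_right (by linarith) (norm_nonneg _)
    linarith
  have hne : ∀ i, ‖κ i‖ ≠ r := by
    intro i hi
    have := hκ i
    rw [hi, sub_self, abs_zero] at this
    linarith
  -- The question is whether an expanding coordinate ever attains the sup norm after time `M`.
  by_cases hd : ∃ n ≥ M, ∃ i, r < ‖κ i‖ ∧ ‖z n i‖ = ‖z n‖
  · right
    obtain ⟨k, hk, i, hi, hik⟩ := hd
    refine ⟨⟨i, hi⟩, r + δ, by linarith, ?_⟩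
    have hind : ∀ n ≥ k, (∃ i, r < ‖κ i‖ ∧ ‖z n i‖ = ‖z n‖) ∧
        ‖z k‖ / (r + δ) ^ k * (r + δ) ^ n ≤ ‖z n‖ := by
      intro n hn
      induction n, hn using Nat.le_induction with
      | base =>
        refine ⟨⟨i, hi, hik⟩, le_of_eq ?_⟩
        field_simp
      | succ n hn ih =>
        obtain ⟨⟨j, hj, hjn⟩, ih⟩ := ih
        have hjb := hbig n (hk.trans hn) j hj hjn
        have hgrow : (r + δ) * ‖z n‖ ≤ ‖z (n + 1)‖ := hjb.trans (norm_le_pi_norm _ _)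
        have hpos : 0 < ‖z n‖ := norm_pos_iff.2 (hz n)
        constructor
        · obtain ⟨q, hq⟩ := hattain (n + 1)
          -- A contracting coordinate is at most `(r - δ) * ‖z n‖`, below the new norm, so it cannot
          -- attain the maximum.
          refine ⟨q, lt_of_not_ge fun hqr => ?_, hq⟩
          have := hsmall n (hk.trans hn) q (lt_of_le_of_ne hqr (hne q))
          rw [hq] at this
          nlinarith
        · calc _ = (r + δ) * (‖z k‖ / (r + δ) ^ k * (r + δ) ^ n) := by ring
            _ ≤ (r + δ) * ‖z n‖ := mul_le_mul_of_nonneg_left ih (by linarith)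
            _ ≤ _ := hgrow
    refine ⟨‖z k‖ / (r + δ) ^ k, ?_, eventually_atTop.2 ⟨k, fun n hn => (hind n hn).2⟩⟩
    have := norm_pos_iff.2 (hz k)
    positivity
  · left
    push Not at hd
    have hlow : ∀ n ≥ M, ‖z (n + 1)‖ ≤ (r - δ) * ‖z n‖ := by
      intro n hn
      obtain ⟨q, hq⟩ := hattain (n + 1)
      rw [← hq]
      refine hsmall n hn q (lt_of_le_of_ne (le_of_not_gt fun hqr => ?_) (hne q))
      exact hd (n + 1) (by omega) q hqr hq
    -- Otherwise the contraction bound would force `z (M + 1) = 0`.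
    have hrδ : 0 < r - δ := by
      have h1 := hlow M le_rfl
      have h2 := norm_pos_iff.2 (hz M)
      have h3 := norm_pos_iff.2 (hz (M + 1))
      by_contra hcon
      nlinarith
    refine ⟨r - δ, hrδ.le, by linarith, ‖z M‖ / (r - δ) ^ M, ?_, eventually_atTop.2 ⟨M, ?_⟩⟩
    · have := norm_pos_iff.2 (hz M)
      positivity
    · intro n hn
      induction n, hn using Nat.le_induction with
      | base =>
        refine le_of_eq ?_
        field_simp
      | succ n hn ih =>
        calc _ ≤ (r - δ) * ‖z n‖ := hlow n hn
          _ ≤ (r - δ) * (‖z M‖ / (r - δ) ^ M * (r - δ) ^ n) :=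
            mul_le_mul_of_nonneg_left ih hrδ.le
          _ = _ := by ring

/-! ### Minors of products -/

/-- Multilinearity in the rows. Keeping all maps `g`, rather than collecting them into increasing
ones as in Cauchy–Binet, suffices for norm bounds. -/
theorem det_submatrix_mul {m k l : ℕ} (M : Matrix (Fin k) (Fin m) ℂ) (Y : Matrix (Fin m) (Fin l) ℂ)
    (f : Fin l → Fin k) :
    ((M * Y).submatrix f id).det =
      ∑ g : Fin l → Fin m, (∏ i, M (f i) (g i)) * (Y.submatrix g id).det := by
  have h1 : (M * Y).submatrix f id = fun i => ∑ j, M (f i) j • Y j := by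
    ext i c
    simp [Matrix.mul_apply, Finset.sum_apply]
  have h2 := (Matrix.detRowAlternating (n := Fin l) (R := ℂ)).toMultilinearMap.map_sum
    fun i (j : Fin m) => M (f i) j • Y j
  rw [h1]
  refine h2.trans (Finset.sum_congr rfl fun g _ => ?_)
  exact MultilinearMap.map_smul_univ _ (fun i => M (f i) (g i)) fun i => Y (g i)

/-- Sorting distinct rows changes only the sign; a repeated row gives zero. -/
theorem norm_det_submatrix_le {m l : ℕ} (Y : Matrix (Fin m) (Fin l) ℂ) (g : Fin l → Fin m) :
    ‖(Y.submatrix g id).det‖ ≤ ‖minorVector Y‖ := by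
  by_cases hg : Function.Injective g
  · set σ := Tuple.sort g
    have hmono : StrictMono (g ∘ σ) :=
      (Tuple.monotone_sort g).strictMono_of_injective (hg.comp σ.injective)
    have h1 := Matrix.det_permute σ (Y.submatrix g id)
    have h2 : ‖((Y.submatrix g id).submatrix σ id).det‖ = ‖(Y.submatrix g id).det‖ := by
      rw [h1, norm_mul]
      rcases Int.units_eq_one_or (Equiv.Perm.sign σ) with h | h <;> simp [h]
    rw [← h2]
    exact norm_le_pi_norm (minorVector Y) (OrderEmbedding.ofStrictMono _ hmono)
  · simp only [Function.Injective, not_forall] at hg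
    obtain ⟨i, j, hij, hne⟩ := hg
    rw [Matrix.det_zero_of_row_eq hne (by ext c; simp [hij]), norm_zero]
    exact norm_nonneg _

theorem exists_norm_minorVector_mul_le {m k l : ℕ} (M : Matrix (Fin k) (Fin m) ℂ) :
    ∃ C > 0, ∀ Y : Matrix (Fin m) (Fin l) ℂ, ‖minorVector (M * Y)‖ ≤ C * ‖minorVector Y‖ := by
  set B : (Fin l → Fin k) → ℝ := fun f => ∑ g : Fin l → Fin m, ‖∏ i, M (f i) (g i)‖
  have hB : ∀ f, 0 ≤ B f := fun f => Finset.sum_nonneg fun _ _ => norm_nonneg _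
  have hS : 0 ≤ ∑ f, B f := Finset.sum_nonneg fun f _ => hB f
  refine ⟨∑ f, B f + 1, by positivity, fun Y => ?_⟩
  refine (pi_norm_le_iff_of_nonneg (by positivity)).2 fun μ => ?_
  have h1 : ‖minorVector (M * Y) μ‖ ≤ B μ * ‖minorVector Y‖ := by
    rw [minorVector, det_submatrix_mul, Finset.sum_mul]
    refine (norm_sum_le _ _).trans (Finset.sum_le_sum fun g _ => ?_)
    rw [norm_mul]
    exact mul_le_mul_of_nonneg_left (norm_det_submatrix_le Y g) (norm_nonneg _)
  have h2 : B μ ≤ ∑ f, B f := Finset.single_le_sum (fun f _ => hB f) (Finset.mem_univ _)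
  exact h1.trans (mul_le_mul_of_nonneg_right (by linarith) (norm_nonneg _))

/-- The expansion coefficients are continuous in `M`, and at the diagonal matrix only `g = μ`
survives. -/
theorem eventually_norm_minorVector_mul_sub_le {m : ℕ} (l : ℕ) (lam : Fin m → ℂ) {δ : ℝ}
    (hδ : 0 < δ) :
    ∀ᶠ M in 𝓝 (Matrix.diagonal lam), ∀ (Y : Matrix (Fin m) (Fin l) ℂ) (μ : Fin l ↪o Fin m),
      ‖minorVector (M * Y) μ - (∏ i, lam (μ i)) * minorVector Y μ‖ ≤ δ * ‖minorVector Y‖ := by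
  classical
  set E : Matrix (Fin m) (Fin m) ℂ → (Fin l ↪o Fin m) → ℝ := fun M μ =>
    ∑ g : Fin l → Fin m, ‖(∏ i, M (μ i) (g i)) - if g = μ then ∏ i, lam (μ i) else 0‖ with hE
  have hE0 : ∀ μ, E (Matrix.diagonal lam) μ = 0 := by
    intro μ
    refine Finset.sum_eq_zero fun g _ => ?_
    rw [norm_eq_zero, sub_eq_zero]
    split_ifs with hg
    · simp [hg]
    · obtain ⟨i, hi⟩ := Function.ne_iff.1 hg
      exact Finset.prod_eq_zero (Finset.mem_univ i) (Matrix.diagonal_apply_ne' _ hi)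
  have hev : ∀ᶠ M in 𝓝 (Matrix.diagonal lam), ∀ μ, E M μ < δ := by
    refine eventually_all.2 fun μ => ?_
    have hc : Continuous fun M => E M μ := by
      simp only [hE]
      fun_prop
    refine hc.continuousAt.eventually (gt_mem_nhds ?_)
    simpa only [hE0] using hδ
  filter_upwards [hev] with M hM Y μ
  have h1 : minorVector (M * Y) μ - (∏ i, lam (μ i)) * minorVector Y μ =
      ∑ g : Fin l → Fin m, ((∏ i, M (μ i) (g i)) - if g = μ then ∏ i, lam (μ i) else 0) *
        (Y.submatrix g id).det := by
    simp only [minorVector, det_submatrix_mul, sub_mul, Finset.sum_sub_distrib, ite_mul, zero_mul,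
      Finset.sum_ite_eq', Finset.mem_univ, if_true]
  rw [h1]
  calc _ ≤ E M μ * ‖minorVector Y‖ := by
        rw [hE, Finset.sum_mul]
        refine (norm_sum_le _ _).trans (Finset.sum_le_sum fun g _ => ?_)
        rw [norm_mul]
        exact mul_le_mul_of_nonneg_left (norm_det_submatrix_le Y g) (norm_nonneg _)
    _ ≤ _ := mul_le_mul_of_nonneg_right (hM μ).le (norm_nonneg _)

/-- A left inverse of `Y` expands `det 1` as a combination of minors of `Y`. -/
theorem minorVector_ne_zero {m l : ℕ} (Y : Matrix (Fin m) (Fin l) ℂ)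
    (hY : ∀ c, Y.mulVec c = 0 → c = 0) : minorVector Y ≠ 0 := by
  intro h0
  obtain ⟨g, hg⟩ := LinearMap.exists_leftInverse_of_injective (Matrix.mulVecLin Y)
    (LinearMap.ker_eq_bot'.2 hY)
  have hB : LinearMap.toMatrix' g * Y = 1 := by
    have := congrArg LinearMap.toMatrix' hg
    rwa [LinearMap.toMatrix'_comp, LinearMap.toMatrix'_id, ← Matrix.toLin'_apply',
      LinearMap.toMatrix'_toLin'] at this
  have h1 := det_submatrix_mul (LinearMap.toMatrix' g) Y id
  rw [hB, Matrix.submatrix_id_id, Matrix.det_one] at h1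
  refine one_ne_zero (h1.trans (Finset.sum_eq_zero fun f _ => ?_))
  have := norm_det_submatrix_le Y f
  rw [h0, norm_zero, norm_le_zero_iff] at this
  rw [this, mul_zero]

/-! ### The companion matrix -/

theorem companionMatrix_pow_zero {m : ℕ} (a : Fin (m + 1 + 1) → ℂ) (k : ℕ) (hk : k < m + 1)
    (j : Fin (m + 1)) : (companionMatrix a ^ k) 0 j = if (j : ℕ) = k then 1 else 0 := by
  induction k generalizing j with
  | zero => simp only [pow_zero, Matrix.one_apply, Fin.ext_iff, Fin.val_zero, @eq_comm ℕ 0]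
  | succ k ih =>
    have hk' : k < m + 1 := by omega
    rw [pow_succ, Matrix.mul_apply, Finset.sum_eq_single ⟨k, hk'⟩]
    · rw [ih hk', companionMatrix]
      simp [show k ≠ m by omega]
    · intro i _ hi
      rw [ih hk', if_neg fun h => hi (Fin.ext h), zero_mul]
    · simp

/-- The first basis row vector is cyclic: powers of the matrix carry it through the standard basis.
-/
theorem aeval_companionMatrix_zero {m : ℕ} (a : Fin (m + 1 + 1) → ℂ) (p : Polynomial ℂ)
    (hp : p.natDegree < m + 1) (j : Fin (m + 1)) :
    (Polynomial.aeval (companionMatrix a) p) 0 j = p.coeff j := by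
  rw [Polynomial.aeval_eq_sum_range' hp, Matrix.sum_apply, Finset.sum_eq_single (j : ℕ)]
  · rw [Matrix.smul_apply, companionMatrix_pow_zero a _ j.2, if_pos rfl, smul_eq_mul, mul_one]
  · intro k hk hkj
    rw [Matrix.smul_apply, companionMatrix_pow_zero a _ (Finset.mem_range.1 hk), if_neg hkj.symm,
      smul_zero]
  · intro h
    exact absurd (Finset.mem_range.2 j.2) h

/-- For `t ≠ 0` the companion matrix is conjugate to the bidiagonal matrix with its eigenvalues on
the diagonal, in any prescribed order, and with entries `t` just above the diagonal. -/
theorem exists_companionMatrix_conj {m : ℕ} (a : Fin (m + 1) → ℂ) (lam : Fin m → ℂ)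
    (hlam : (companionMatrix a).charpoly.roots = Finset.univ.val.map lam) {t : ℂ} (ht : t ≠ 0) :
    ∃ S S' : Matrix (Fin m) (Fin m) ℂ, S' * S = 1 ∧ S * companionMatrix a * S' =
      Matrix.diagonal lam + t • Matrix.of fun i j : Fin m => if (j : ℕ) = i + 1 then 1 else 0 := by
  cases m with
  | zero => exact ⟨1, 1, Subsingleton.elim _ _, Subsingleton.elim _ _⟩
  | succ m =>
  set Ψ := companionMatrix a with hΨ
  set q : ℕ → Polynomial ℂ := fun i =>
    Polynomial.X - Polynomial.C (if h : i < m + 1 then lam ⟨i, h⟩ else 0) with hq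
  set p : ℕ → Polynomial ℂ := fun k => ∏ i ∈ Finset.range k, q i with hp
  have hmonic : ∀ k, (p k).Monic := fun k =>
    Polynomial.monic_prod_of_monic _ _ fun i _ => Polynomial.monic_X_sub_C _
  have hdeg : ∀ k, (p k).natDegree = k := by
    intro k
    rw [hp, Polynomial.natDegree_prod_of_monic _ _ fun i _ => Polynomial.monic_X_sub_C _]
    simp [hq]
  have hchar : p (m + 1) = Ψ.charpoly := by
    rw [(IsAlgClosed.splits Ψ.charpoly).eq_prod_roots_of_monic (Matrix.charpoly_monic _), hlam,
      Multiset.map_map]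
    simp only [hp, Finset.prod_range, hq, Fin.is_lt, dif_pos]
    rfl
  have haeval : Polynomial.aeval Ψ (p (m + 1)) = 0 := by
    rw [hchar, Matrix.aeval_self_charpoly]
  have hrec : ∀ k : Fin (m + 1), Polynomial.aeval Ψ (p k) * Ψ =
      lam k • Polynomial.aeval Ψ (p k) + Polynomial.aeval Ψ (p (k + 1)) := by
    intro k
    have h1 : p (k + 1) = p k * (Polynomial.X - Polynomial.C (lam k)) := by
      simp only [hp, Finset.prod_range_succ, hq, Fin.is_lt, dif_pos]
    rw [h1, map_mul, map_sub, Polynomial.aeval_X, Polynomial.aeval_C, mul_sub,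
      Algebra.algebraMap_eq_smul_one, mul_smul_comm, mul_one]
    abel
  -- The rows are the Newton basis `p k` of the eigenvalues, evaluated at `Ψ` on the cyclic vector;
  -- scaling by `t⁻¹ ^ k` turns the superdiagonal ones into `t`.
  set S : Matrix (Fin (m + 1)) (Fin (m + 1)) ℂ :=
    Matrix.of fun k j => t⁻¹ ^ (k : ℕ) * (Polynomial.aeval Ψ (p k)) 0 j with hS
  have hdet : IsUnit S.det := by
    rw [Matrix.det_of_isLowerTriangular S]
    · refine isUnit_iff_ne_zero.2 (Finset.prod_ne_zero_iff.2 fun k _ => ?_)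
      have h1 : (p k).coeff k = 1 := by
        have := (hmonic k).coeff_natDegree
        rwa [hdeg] at this
      rw [hS, Matrix.of_apply, aeval_companionMatrix_zero a _ (by rw [hdeg]; exact k.2), h1,
        mul_one]
      exact pow_ne_zero _ (inv_ne_zero ht)
    · intro i j hij
      have hij' : (i : ℕ) < j := hij
      rw [hS, Matrix.of_apply, aeval_companionMatrix_zero a _ (by rw [hdeg]; exact i.2),
        Polynomial.coeff_eq_zero_of_natDegree_lt (by rwa [hdeg]), mul_zero]
  refine ⟨S, S⁻¹, Matrix.nonsing_inv_mul S hdet, ?_⟩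
  have hmul : S * Ψ = (Matrix.diagonal lam + t • Matrix.of fun i j : Fin (m + 1) =>
      if (j : ℕ) = i + 1 then (1 : ℂ) else 0) * S := by
    ext k j
    have h1 : (S * Ψ) k j = t⁻¹ ^ (k : ℕ) * (Polynomial.aeval Ψ (p k) * Ψ) 0 j := by
      simp only [hS, Matrix.mul_apply, Matrix.of_apply, Finset.mul_sum, mul_assoc]
    have h3 : (lam k • Polynomial.aeval Ψ (p k) + Polynomial.aeval Ψ (p (k + 1))) 0 j =
        lam k * (Polynomial.aeval Ψ (p k)) 0 j + (Polynomial.aeval Ψ (p (k + 1))) 0 j := rfl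
    have h4 : (Matrix.diagonal lam * S) k j =
        lam k * (t⁻¹ ^ (k : ℕ) * (Polynomial.aeval Ψ (p k)) 0 j) := Matrix.diagonal_mul _ _ _ _
    rw [h1, hrec, h3, Matrix.add_mul, Matrix.add_apply, h4, Matrix.smul_mul, Matrix.smul_apply,
      Matrix.mul_apply]
    have h2 : t⁻¹ ^ (k : ℕ) * (Polynomial.aeval Ψ (p (k + 1))) 0 j = t • ∑ i : Fin (m + 1),
        (Matrix.of fun i j : Fin (m + 1) => if (j : ℕ) = i + 1 then (1 : ℂ) else 0) k i * S i j := by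
      by_cases hk : (k : ℕ) + 1 < m + 1
      · rw [Finset.sum_eq_single ⟨k + 1, hk⟩]
        · simp only [hS, Matrix.of_apply, if_true, one_mul, smul_eq_mul, pow_succ]
          field_simp
        · intro i _ hi
          rw [Matrix.of_apply, if_neg fun h => hi (Fin.ext h), zero_mul]
        · simp
      -- In the last row Cayley–Hamilton kills `p (m + 1)`.
      · have hk' : (k : ℕ) + 1 = m + 1 := by omega
        rw [hk', haeval, Matrix.zero_apply, mul_zero, Finset.sum_eq_zero, smul_zero]
        intro i _
        rw [Matrix.of_apply, if_neg (by omega), zero_mul]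
    rw [mul_add, h2]
    ring
  rw [hmul, Matrix.mul_assoc, Matrix.mul_nonsing_inv S hdet, Matrix.mul_one]

theorem exists_companionMatrix_conj_of_eventually {m : ℕ} (a : Fin (m + 1) → ℂ) (lam : Fin m → ℂ)
    (hlam : (companionMatrix a).charpoly.roots = Finset.univ.val.map lam)
    {P : Matrix (Fin m) (Fin m) ℂ → Prop} (hP : ∀ᶠ M in 𝓝 (Matrix.diagonal lam), P M) :
    ∃ S S' : Matrix (Fin m) (Fin m) ℂ, S' * S = 1 ∧ P (S * companionMatrix a * S') := by
  have hc : Tendsto (fun t : ℂ => Matrix.diagonal lam +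
      t • Matrix.of fun i j : Fin m => if (j : ℕ) = i + 1 then (1 : ℂ) else 0) (𝓝[≠] 0)
      (𝓝 (Matrix.diagonal lam)) := by
    refine tendsto_nhdsWithin_of_tendsto_nhds (Continuous.tendsto' (by fun_prop) _ _ ?_)
    rw [zero_smul, add_zero]
  obtain ⟨t, hPt, ht⟩ := ((hc.eventually hP).and self_mem_nhdsWithin).exists
  obtain ⟨S, S', h1, h2⟩ := exists_companionMatrix_conj a lam hlam ht
  exact ⟨S, S', h1, h2 ▸ hPt⟩

theorem tendsto_companionMatrix {m : ℕ} {α : ℕ → Fin (m + 1) → ℂ} {a : Fin (m + 1) → ℂ}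
    (hlim : ∀ j, Tendsto (fun n => α n j) atTop (𝓝 (a j))) (ha_high : a (Fin.last m) ≠ 0) :
    Tendsto (fun n => companionMatrix (α n)) atTop (𝓝 (companionMatrix a)) := by
  refine tendsto_pi_nhds.2 fun i => tendsto_pi_nhds.2 fun j => ?_
  simp only [companionMatrix, Matrix.of_apply]
  split_ifs
  · exact ((hlim _).div (hlim _) ha_high).neg
  · exact tendsto_const_nhds
  · exact tendsto_const_nhds

/-! ### Solutions and their Casoratian -/

theorem casoratian_succ {m l : ℕ} {α : ℕ → Fin (m + 1) → ℂ}
    (hα_high : ∀ n, α n (Fin.last m) ≠ 0) {x : Fin l → ℕ → ℂ}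
    (hx : ∀ j, IsRecurrenceSolution α (x j)) (n : ℕ) :
    casoratian m x (n + 1) = companionMatrix (α n) * casoratian m x n := by
  ext i c
  simp only [casoratian, Matrix.mul_apply, companionMatrix, Matrix.of_apply]
  by_cases hi : (i : ℕ) + 1 = m
  · simp only [hi, if_true]
    have h1 := hx c n
    rw [Fin.sum_univ_castSucc] at h1
    simp only [Fin.val_castSucc, Fin.val_last] at h1
    have h2 : n + 1 + (i : ℕ) = n + m := by omega
    have h3 : ∑ j : Fin m, -(α n j.castSucc / α n (Fin.last m)) * x c (n + j) =
        -(∑ j : Fin m, α n j.castSucc * x c (n + j)) / α n (Fin.last m) := by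
      rw [neg_div, Finset.sum_div, ← Finset.sum_neg_distrib]
      exact Finset.sum_congr rfl fun j _ => by ring
    rw [h2, h3, eq_div_iff (hα_high n)]
    linear_combination h1
  · have hi' : (i : ℕ) + 1 < m := by omega
    simp only [hi, if_false]
    rw [Finset.sum_eq_single ⟨i + 1, hi'⟩]
    · simp [add_assoc, add_comm (i : ℕ)]
    · intro j _ hj
      rw [if_neg fun h => hj (Fin.ext h), zero_mul]
    · simp

/-- A window of `m` zeros spreads upward through the leading coefficient and downward through the
trailing one. -/
theorem IsRecurrenceSolution.eq_zero {m : ℕ} {α : ℕ → Fin (m + 1) → ℂ} {y : ℕ → ℂ}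
    (hy : IsRecurrenceSolution α y) (hα_low : ∀ n, α n 0 ≠ 0)
    (hα_high : ∀ n, α n (Fin.last m) ≠ 0) (n : ℕ) (h0 : ∀ i < m, y (n + i) = 0) : y = 0 := by
  have hup : ∀ k, n ≤ k → ∀ i < m, y (k + i) = 0 := by
    intro k hk
    induction k, hk using Nat.le_induction with
    | base => exact h0
    | succ k hk ih =>
      intro i hi
      by_cases him : i + 1 < m
      · rw [add_assoc, add_comm 1]
        exact ih _ him
      · have h1 := hy k
        rw [Fin.sum_univ_castSucc, Finset.sum_eq_zero fun j _ => by
          rw [Fin.val_castSucc, ih _ j.2, mul_zero], zero_add, Fin.val_last] at h1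
        rw [show k + 1 + i = k + m by omega]
        exact (mul_eq_zero.1 h1).resolve_left (hα_high k)
  have hdown : ∀ k, k ≤ n → ∀ i < m, y (k + i) = 0 := by
    intro k hk
    induction hk using Nat.decreasingInduction with
    | self => exact h0
    | of_succ k hk ih =>
      intro i hi
      rcases i with _ | i
      · have h1 := hy k
        rw [Fin.sum_univ_succ, Finset.sum_eq_zero fun (j : Fin m) _ => by
          rw [Fin.val_succ, show k + ((j : ℕ) + 1) = k + 1 + j by omega, ih _ j.2, mul_zero],
          add_zero] at h1
        exact (mul_eq_zero.1 h1).resolve_left (hα_low k)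
      · rw [show k + (i + 1) = k + 1 + i by omega]
        exact ih _ (by omega)
  funext k
  rcases Nat.eq_zero_or_pos m with rfl | hm
  · have h1 := hy k
    rw [Fin.sum_univ_one] at h1
    exact (mul_eq_zero.1 h1).resolve_left (hα_low k)
  · exact (le_total k n).elim (fun h => hdown k h 0 hm) fun h => hup k h 0 hm

theorem minorVector_casoratian_ne_zero {m l : ℕ} {α : ℕ → Fin (m + 1) → ℂ}
    (hα_low : ∀ n, α n 0 ≠ 0) (hα_high : ∀ n, α n (Fin.last m) ≠ 0) {x : Fin l → ℕ → ℂ}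
    (hx : ∀ j, IsRecurrenceSolution α (x j)) (hx_ind : LinearIndependent ℂ x) (n : ℕ) :
    minorVector (casoratian m x n) ≠ 0 := by
  refine minorVector_ne_zero _ fun c hc => ?_
  have hsol : IsRecurrenceSolution α (∑ j, c j • x j) := by
    intro k
    simp only [Finset.sum_apply, Pi.smul_apply, smul_eq_mul, Finset.mul_sum]
    rw [Finset.sum_comm]
    refine Finset.sum_eq_zero fun j _ => ?_
    have := congrArg (c j * ·) (hx j k)
    simp only [Finset.mul_sum, mul_zero] at this
    rw [← this]
    exact Finset.sum_congr rfl fun i _ => by ring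
  have hzero := hsol.eq_zero hα_low hα_high n fun i hi => by
    have := congrFun hc ⟨i, hi⟩
    simpa [Matrix.mulVec, dotProduct, casoratian, mul_comm] using this
  exact funext (Fintype.linearIndependent_iff.1 hx_ind c hzero)

/-! ### Norms on spaces of vectors -/

theorem exists_seminorm_equiv {ι : Type*} [Fintype ι] (N : Seminorm ℂ (ι → ℂ))
    (hN : ∀ v, N v = 0 → v = 0) :
    ∃ c > 0, ∃ C > 0, ∀ v, N v ≤ C * ‖v‖ ∧ ‖v‖ ≤ c * N v := by
  classical
  obtain ⟨C, hC, hCN⟩ : ∃ C > 0, ∀ v, N v ≤ C * ‖v‖ := by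
    have hS : 0 ≤ ∑ i, N (Pi.single i 1) := Finset.sum_nonneg fun i _ => apply_nonneg N _
    refine ⟨∑ i, N (Pi.single i 1) + 1, by positivity, fun v => ?_⟩
    calc N v = N (∑ i, v i • Pi.single i (1 : ℂ)) := by rw [← pi_eq_sum_univ' v]
      _ ≤ ∑ i, N (v i • Pi.single i (1 : ℂ)) :=
        Finset.le_sum_of_subadditive N (map_zero N).le (map_add_le_add N) _ _
      _ ≤ ∑ i, N (Pi.single i 1) * ‖v‖ := by
        refine Finset.sum_le_sum fun i _ => ?_
        rw [map_smul_eq_mul, mul_comm]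
        exact mul_le_mul_of_nonneg_left (norm_le_pi_norm v i) (apply_nonneg N _)
      _ ≤ _ := by
        rw [← Finset.sum_mul]
        exact mul_le_mul_of_nonneg_right (by linarith) (norm_nonneg _)
  have hcont : Continuous N :=
    Seminorm.continuous_of_le (q := NNReal.mk C hC.le • normSeminorm ℂ (ι → ℂ))
      (continuous_const.mul continuous_norm) hCN
  have hK : IsCompact (Metric.sphere (0 : ι → ℂ) 1) := isCompact_sphere 0 1
  -- The sphere is empty exactly when `ι` is.
  rcases (Metric.sphere (0 : ι → ℂ) 1).eq_empty_or_nonempty with he | hne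
  · refine ⟨1, one_pos, C, hC, fun v => ⟨hCN v, ?_⟩⟩
    by_cases hv : v = 0
    · simp [hv]
    · have : (‖v‖⁻¹ : ℂ) • v ∈ Metric.sphere (0 : ι → ℂ) 1 := by
        rw [mem_sphere_zero_iff_norm, norm_smul, norm_inv, Complex.norm_real, norm_norm,
          inv_mul_cancel₀ (norm_ne_zero_iff.2 hv)]
      rw [he] at this
      exact this.elim
  · obtain ⟨u, hu, humin⟩ := hK.exists_isMinOn hne hcont.continuousOn
    have hu1 : ‖u‖ = 1 := by simpa using hu
    have hNu : 0 < N u := lt_of_le_of_ne (apply_nonneg N u) fun h => by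
      rw [hN u h.symm, norm_zero] at hu1
      exact zero_ne_one hu1
    refine ⟨(N u)⁻¹, inv_pos.2 hNu, C, hC, fun v => ⟨hCN v, ?_⟩⟩
    by_cases hv : v = 0
    · simp [hv]
    · have hmem : (‖v‖⁻¹ : ℂ) • v ∈ Metric.sphere (0 : ι → ℂ) 1 := by
        rw [mem_sphere_zero_iff_norm, norm_smul, norm_inv, Complex.norm_real, norm_norm,
          inv_mul_cancel₀ (norm_ne_zero_iff.2 hv)]
      have h1 : N u ≤ N ((‖v‖⁻¹ : ℂ) • v) := humin hmem
      rw [map_smul_eq_mul, norm_inv, Complex.norm_real, norm_norm,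
        le_inv_mul_iff₀ (norm_pos_iff.2 hv)] at h1
      rw [le_inv_mul_iff₀ hNu]
      linarith

/-! ### The main theorem -/

theorem theorem3p3 (m l : ℕ)
    (α : ℕ → Fin (m + 1) → ℂ) (a : Fin (m + 1) → ℂ)
    (hα_low : ∀ n, α n 0 ≠ 0) (hα_high : ∀ n, α n (Fin.last m) ≠ 0)
    (hlim : ∀ j, Filter.Tendsto (fun n => α n j) Filter.atTop (nhds (a j)))
    (ha_low : a 0 ≠ 0) (ha_high : a (Fin.last m) ≠ 0)
    (x : Fin l → ℕ → ℂ)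
    (hx : ∀ j, IsRecurrenceSolution α (x j))
    (hx_ind : LinearIndependent ℂ x)
    (lam : Fin m → ℂ)
    -- `lam` lists the eigenvalues of the limiting companion matrix, with algebraic multiplicity
    (hlam : (companionMatrix a).charpoly.roots = Finset.univ.val.map lam) :
    ∃ ν : Fin l ↪o Fin m,
      -- an arbitrary norm `N` on the space of vectors of minors
      ∀ N : Seminorm ℂ ((Fin l ↪o Fin m) → ℂ), (∀ v, N v = 0 → v = 0) →
        Filter.Tendsto
          (fun n : ℕ => (N (minorVector (casoratian m x n))) ^ (1 / (n : ℝ)))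
          Filter.atTop (nhds ‖∏ i, lam (ν i)‖) := by
  set κ : (Fin l ↪o Fin m) → ℂ := fun μ => ∏ i, lam (μ i)
  set X := casoratian m x
  have hX0 : ∀ n, minorVector (X n) ≠ 0 :=
    minorVector_casoratian_ne_zero hα_low hα_high hx hx_ind
  obtain ⟨ρ, ⟨ν, hν⟩, hρ⟩ := exists_tendsto_rpow_of_dichotomy
    (Set.finite_range fun μ => ‖κ μ‖) (fun n => ‖minorVector (X n)‖)
    (fun n => norm_pos_iff.2 (hX0 n)) (by
      intro r hr hrF
      have hgap : ∃ δ > 0, ∀ μ, 2 * δ ≤ |‖κ μ‖ - r| := by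
        have h1 : ∀ᶠ δ : ℝ in 𝓝[>] 0, ∀ μ, 2 * δ ≤ |‖κ μ‖ - r| := by
          refine eventually_all.2 fun μ => ?_
          have h2 : 0 < |‖κ μ‖ - r| := abs_pos.2 (sub_ne_zero.2 fun h => hrF ⟨μ, h⟩)
          filter_upwards [Ioo_mem_nhdsGT (half_pos h2)] with δ hδ
          linarith [hδ.2]
        obtain ⟨δ, h3, h4⟩ := (h1.and self_mem_nhdsWithin).exists
        exact ⟨δ, h4, h3⟩
      obtain ⟨δ, hδ, hκ⟩ := hgap
      obtain ⟨S, S', hSS, hP⟩ := exists_companionMatrix_conj_of_eventually a lam hlam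
        -- The estimate is required on a whole neighbourhood of the conjugated limit, so that it
        -- passes to `S * companionMatrix (α n) * S'` for large `n`.
        (eventually_eventually_nhds.2 (eventually_norm_minorVector_mul_sub_le l lam hδ))
      have hSX : ∀ n, S' * (S * X n) = X n := fun n => by
        rw [← Matrix.mul_assoc, hSS, Matrix.one_mul]
      obtain ⟨C, hC, hCb⟩ := exists_norm_minorVector_mul_le (l := l) S
      obtain ⟨C', hC', hCb'⟩ := exists_norm_minorVector_mul_le (l := l) S'
      have hup : ∀ n, ‖minorVector (X n)‖ ≤ C' * ‖minorVector (S * X n)‖ := fun n => by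
        have := hCb' (S * X n)
        rwa [hSX] at this
      have hlim' : Tendsto (fun n => S * companionMatrix (α n) * S') atTop
          (𝓝 (S * companionMatrix a * S')) :=
        ((tendsto_const_nhds (x := S)).mul (tendsto_companionMatrix hlim ha_high)).mul
          tendsto_const_nhds
      rcases growth_dichotomy κ hδ hr hκ (fun n => minorVector (S * X n))
        (fun n h => hX0 n (norm_le_zero_iff.1 (by simpa [h] using hup n)))
        (by
          filter_upwards [hlim'.eventually hP] with n hn μ
          have h1 := hn (S * X n) μ
          rwa [Matrix.mul_assoc _ S', hSX, Matrix.mul_assoc S, ← casoratian_succ hα_high hx] at h1)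
        with ⟨s, hs0, hsr, D, hD, h⟩ | ⟨⟨μ, hμ⟩, s, hs, c, hc, h⟩
      · refine Or.inl ⟨s, hs0, hsr, C' * D, by positivity, ?_⟩
        filter_upwards [h] with n hn
        rw [mul_assoc]
        exact (hup n).trans (mul_le_mul_of_nonneg_left hn hC'.le)
      · refine Or.inr ⟨⟨_, ⟨μ, rfl⟩, hμ⟩, s, hs, C⁻¹ * c, by positivity, ?_⟩
        filter_upwards [h] with n hn
        rw [mul_assoc, inv_mul_le_iff₀ hC]
        exact hn.trans (hCb (X n)))
  refine ⟨ν, fun N hN => ?_⟩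
  obtain ⟨c, hc, C, hC, hNe⟩ := exists_seminorm_equiv N hN
  -- Since `B ^ (1 / n)` tends to `1`, equivalent norms give the same limit.
  have hconst : ∀ B > 0, Tendsto (fun n : ℕ => (B * ‖minorVector (X n)‖) ^ (1 / (n : ℝ))) atTop
      (𝓝 ‖κ ν‖) := by
    intro B hB
    have h1 := (tendsto_const_nhds.rpow tendsto_one_div_atTop_nhds_zero_nat
      (Or.inl (ne_of_gt hB))).mul hρ
    rw [Real.rpow_zero, one_mul, ← hν] at h1
    refine h1.congr fun n => ?_
    rw [Real.mul_rpow hB.le (norm_nonneg _)]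
  refine tendsto_of_tendsto_of_tendsto_of_le_of_le (hconst c⁻¹ (inv_pos.2 hc)) (hconst C hC)
    (fun n => Real.rpow_le_rpow (by positivity) ?_ (by positivity))
    (fun n => Real.rpow_le_rpow (apply_nonneg N _) (hNe _).1 (by positivity))
  rw [inv_mul_le_iff₀ hc]
  exact (hNe _).2
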